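/- Let $I$ be a set of unary connectives. Formulas are built from variables with $\bot,\vee,\cdot,\to$ and the connectives $m\in I$; put $\top:=\bot\to\bot$ (this is the constant $1$). Let $S_{\mathcal H}$ be the logic given by the Hilbert calculus with axioms (1) $\varphi\to\varphi$; (2) $(\varphi\to\psi)\to[(\psi\to\chi)\to(\varphi\to\chi)]$; (3) $\varphi\cdot\psi\to\varphi$; (4) $\varphi\cdot\psi\to\psi\cdot\varphi$; (5) $[(\varphi\cdot\psi)\to\chi]\to[\psi\to(\varphi\to\chi)]$; (6) $[\psi\to(\varphi\to\chi)]\to[(\varphi\cdot\psi)\to\chi]$; (7) $\varphi\to(\varphi\vee\psi)$; (8) $\psi\to(\varphi\vee\psi)$; (9) $\varphi\cdot(\psi\vee\chi)\to[(\varphi\cdot\psi)\vee(\varphi\cdot\chi)]$; (10) $\bot\to\varphi$; and, for all $m\in I$, (11) $m(\top)\to\top$ and $\top\to m(\top)$; (12) $m(\varphi\to\psi)\to(m(\varphi)\to m(\psi))$; and rules $\varphi\to\psi,\varphi\rhd\psi$; $\ \varphi\rhd m(\varphi)$ for all $m\in I$; $\ \varphi\to\chi,\psi\to\chi\rhd(\varphi\vee\psi)\to\chi$.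 An $I$-modal ririg is an algebra $(A,\vee,\cdot,\to,0,1,\{m\}_{m\in I})$ such that $(A,\vee,0)$ and $(A,\cdot,1)$ are commutative monoids, $x\cdot 0=0$, $x(y\vee z)=xy\vee xz$, $1\vee x=1$, $xy\le z\Leftrightarrow x\le y\to z$ (where $x\le y$ means $x\vee y=y$), and $m(x\to y)\le m(x)\to m(y)$, $m(1)=1$ for all $m\in I$. Let $\mathcal R(I)$ be the variety of these algebras. An axiomatic extension of $S_{\mathcal H}$ is a logic obtained from it by adding, as axioms, all substitution instances of a set of formulas. A logic $L$ is algebraized by a class $\mathcal V$ if there are structural (substitution-commuting) transformers $\tau:\mathrm{Fm}\to\mathcal P(\mathrm{Eq})$ and $\rho:\mathrm{Eq}\to\mathcal P(\mathrm{Fm})$ with $\Gamma\vdash_L\varphi\Leftrightarrow\tau[\Gamma]\models_{\mathcal V}\tau(\varphi)$, $\Theta\models_{\mathcal V}\varepsilon\Leftrightarrow\rho[\Theta]\vdash_L\rho(\varepsilon)$, and, moreover, $\varphi$ interderivable in $L$ with $\rho[\tau(\varphi)]$ and $\varepsilon$ equivalent over $\models_{\mathcal V}$ to $\tau[\rho(\varepsilon)]$.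 An $I$-block is a finite word $M=m_1\cdots m_r$ over $I$ (possibly empty), and $M(\varphi)=m_1(\cdots m_r(\varphi)\cdots)$. The empty product is $\top$. (a) Let $L$ be an axiomatic extension of $S_{\mathcal H}$ that is algebraized by a subvariety $\mathcal V$ of $\mathcal R(I)$, and let $\Gamma\cup\Delta\cup\{\psi\}$ be a set of formulas. Then $\Gamma,\Delta\vdash_L\psi$ if and only if for some $n\ge 0$ there are $I$-blocks $M_1,\dots,M_n$ and $\psi_1,\dots,\psi_n\in\Delta$ (not necessarily distinct) with $\Gamma\vdash_L\prod_{j=1}^nM_j(\psi_j)\to\psi$. (b) Suppose in addition that $I=\{m_1,\dots,m_k\}$ is finite, and let $\lambda(\varphi)=\varphi\cdot\prod_{j=1}^k m_j(\varphi)$, $\lambda^0(\varphi)=\varphi$, $\lambda^{l+1}(\varphi)=\lambda(\lambda^l(\varphi))$. Then $\Gamma,\Delta\vdash_L\psi$ if and only if for some $n\ge 0$ there are $l\ge 0$ and $\psi_1,\dots,\psi_n\in\Delta$ (not necessarily distinct) with $\Gamma\vdash_L\prod_{j=1}^n\lambda^l(\psi_j)\to\psi$. (c) $S_{\mathcal H}$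 has the local deduction-detachment theorem: there is a family $(d_j(p,q))_{j\in J}$ of sets of formulas in at most two variables such that for all sets of formulas $\Gamma\cup\{\varphi,\psi\}$: $\Gamma,\varphi\vdash_{S_{\mathcal H}}\psi$ if and only if $\Gamma\vdash_{S_{\mathcal H}}d_j(\varphi,\psi)$ for some $j\in J$. One such family is $d_{M_1,\dots,M_n}(p,q)=\{M_1(p)\cdots M_n(p)\to q\}$, indexed by the finite sequences of $I$-blocks; if $I$ is finite, another is $d_{n,l}(p,q)=\{(\lambda^l(p))^n\to q\}$, $n,l\ge 0$. -/

import Mathlib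

universe u v w

namespace IModal

/-- Formulas over the set `Var` of variables in the language `∨, ·, →, ⊥, (m)_{m ∈ I}`.
The constant `1` is the abbreviation `⊥ → ⊥`, see `Fm.top`. -/
inductive Fm (I : Type u) (Var : Type v) : Type (max u v) where
  | var : Var → Fm I Var
  | bot : Fm I Var
  | disj : Fm I Var → Fm I Var → Fm I Var
  | mul : Fm I Var → Fm I Var → Fm I Var
  | imp : Fm I Var → Fm I Var → Fm I Var
  | box : I → Fm I Var → Fm I Var

namespace Fm

variable {I : Type u} {Var : Type v} {Var' : Type w}

/-- `⊤ := ⊥ → ⊥`. -/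
def top : Fm I Var := imp bot bot

/-- The homomorphism of formula algebras that extends `σ : Var → Fm I Var'`
(for `Var' = Var` these are exactly the endomorphisms of the formula algebra). -/
def subst (σ : Var → Fm I Var') : Fm I Var → Fm I Var'
  | var x => σ x
  | bot => bot
  | disj φ ψ => disj (subst σ φ) (subst σ ψ)
  | mul φ ψ => mul (subst σ φ) (subst σ ψ)
  | imp φ ψ => imp (subst σ φ) (subst σ ψ)
  | box m φ => box m (subst σ φ)

/-- The formula `M(φ)` for an `I`-block `M`, that is, a word in the alphabet `I`:
`ε(φ) = φ` and `(mN)(φ) = m(N(φ))`. -/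
def block : List I → Fm I Var → Fm I Var
  | [], φ => φ
  | m :: N, φ => box m (block N φ)

/-- The product `φ₁ · … · φₙ`; it is `⊤` for `n = 0` and `φ₁` for `n = 1`. -/
def prod : List (Fm I Var) → Fm I Var
  | [] => top
  | [φ] => φ
  | φ :: χ :: l => mul φ (prod (χ :: l))

/-- `λ(φ) = φ · (m₁(φ) · … · m_k(φ))`, where `e` enumerates `I` as `m₁, …, m_k`. -/
def lam {k : ℕ} (e : Fin k ≃ I) (φ : Fm I Var) : Fm I Var :=
  mul φ (prod (List.ofFn fun j => box (e j) φ))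

/-- `λ^l(φ)`. -/
def lamIter {k : ℕ} (e : Fin k ≃ I) (l : ℕ) (φ : Fm I Var) : Fm I Var :=
  (lam e)^[l] φ

end Fm

/-- A deductive system (logic) in the language of `I`-modal ririgs. -/
structure DeductiveSystem (I : Type u) (Var : Type v) where
  Entails : Set (Fm I Var) → Fm I Var → Prop
  of_mem : ∀ {Γ φ}, φ ∈ Γ → Entails Γ φ
  weaken : ∀ {Γ Δ φ}, Entails Γ φ → Γ ⊆ Δ → Entails Δ φ
  cut : ∀ {Γ Δ φ}, Entails Γ φ → (∀ γ ∈ Γ, Entails Δ γ) → Entails Δ φ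
  structural : ∀ {Γ φ} (σ : Var → Fm I Var),
    Entails Γ φ → Entails (Fm.subst σ '' Γ) (Fm.subst σ φ)

section Calculus

variable {I : Type u} {Var : Type v}

open Fm

/-- The axioms of the Hilbert calculus. -/
inductive HAxiom : Fm I Var → Prop where
  | a1 (φ) : HAxiom (imp φ φ)
  | a2 (φ ψ χ) : HAxiom (imp (imp φ ψ) (imp (imp ψ χ) (imp φ χ)))
  | a3 (φ ψ) : HAxiom (imp (mul φ ψ) φ)
  | a4 (φ ψ) : HAxiom (imp (mul φ ψ) (mul ψ φ))
  | a5 (φ ψ χ) : HAxiom (imp (imp (mul φ ψ) χ) (imp ψ (imp φ χ)))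
  | a6 (φ ψ χ) : HAxiom (imp (imp ψ (imp φ χ)) (imp (mul φ ψ) χ))
  | a7 (φ ψ) : HAxiom (imp φ (disj φ ψ))
  | a8 (φ ψ) : HAxiom (imp ψ (disj φ ψ))
  | a9 (φ ψ χ) : HAxiom (imp (mul φ (disj ψ χ)) (disj (mul φ ψ) (mul φ χ)))
  | a10 (φ) : HAxiom (imp bot φ)
  | m11l (m : I) : HAxiom (imp (box m top) top)
  | m11r (m : I) : HAxiom (imp top (box m top))
  | m12 (m : I) (φ ψ) : HAxiom (imp (box m (imp φ ψ)) (imp (box m φ) (box m ψ)))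

/-- Derivability from `Γ` in the Hilbert calculus. All rules being finitary, only finitely many
members of `Γ` are used in a derivation. -/
inductive Derivable (Γ : Set (Fm I Var)) : Fm I Var → Prop where
  | ax {φ} : HAxiom φ → Derivable Γ φ
  | hyp {φ} : φ ∈ Γ → Derivable Γ φ
  | mp {φ ψ} : Derivable Γ (imp φ ψ) → Derivable Γ φ → Derivable Γ ψ
  | nec (m : I) {φ} : Derivable Γ φ → Derivable Γ (box m φ)
  | disjE {φ ψ χ} : Derivable Γ (imp φ χ) → Derivable Γ (imp ψ χ) →
      Derivable Γ (imp (disj φ ψ) χ)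

theorem HAxiom.subst {φ : Fm I Var} (σ : Var → Fm I Var) (h : HAxiom φ) :
    HAxiom (Fm.subst σ φ) := by
  cases h <;> constructor

theorem Derivable.cut {Γ Δ : Set (Fm I Var)} {φ : Fm I Var} (h : Derivable Γ φ)
    (hΔ : ∀ γ ∈ Γ, Derivable Δ γ) : Derivable Δ φ := by
  induction h with
  | ax h => exact .ax h
  | hyp h => exact hΔ _ h
  | mp _ _ ih₁ ih₂ => exact .mp ih₁ ih₂
  | nec m _ ih => exact .nec m ih
  | disjE _ _ ih₁ ih₂ => exact .disjE ih₁ ih₂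

theorem Derivable.structural {Γ : Set (Fm I Var)} {φ : Fm I Var} (σ : Var → Fm I Var)
    (h : Derivable Γ φ) : Derivable (Fm.subst σ '' Γ) (Fm.subst σ φ) := by
  induction h with
  | ax h => exact .ax (h.subst σ)
  | hyp h => exact .hyp ⟨_, h, rfl⟩
  | mp _ _ ih₁ ih₂ => exact .mp ih₁ ih₂
  | nec m _ ih => exact .nec m ih
  | disjE _ _ ih₁ ih₂ => exact .disjE ih₁ ih₂

/-- The deductive system `S_H` of the Hilbert calculus. -/
def SH (I : Type u) (Var : Type v) : DeductiveSystem I Var where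
  Entails := Derivable
  of_mem h := .hyp h
  weaken h hs := h.cut fun _ hγ => .hyp (hs hγ)
  cut h hΔ := h.cut hΔ
  structural σ h := h.structural σ

/-- `L` is the extension of `S_H` by a set `Ax` of axioms, understood as axiom schemes:
`Γ ⊢_L φ` means that `φ` follows in `S_H` from `Γ` and the substitution instances of
members of `Ax`. -/
def IsAxiomaticExtension (L : DeductiveSystem I Var) : Prop :=
  ∃ Ax : Set (Fm I Var), ∀ Γ φ, L.Entails Γ φ ↔
    (SH I Var).Entails (Γ ∪ {α | ∃ σ : Var → Fm I Var, ∃ β ∈ Ax, α = Fm.subst σ β}) φ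

end Calculus

/-- An `I`-modal ririg on `A`: a rig (a commutative semiring, with `+` in the role of `∨`) which is
integral and residuated for the order `a ≤ b ↔ a + b = b`, with a modal operator
for every `m ∈ I`. -/
class ModalRirig (I : Type u) (A : Type w) extends CommSemiring A where
  /-- the residual `a → b` -/
  imp : A → A → A
  /-- the operators `m ∈ I` -/
  box : I → A → A
  one_add' : ∀ a : A, 1 + a = 1
  /-- `a · b ≤ c ↔ a ≤ b → c` -/
  residuation : ∀ a b c : A, a * b + c = c ↔ a + imp b c = imp b c
  box_one : ∀ m : I, box m 1 = 1
  /-- `m(a → b) ≤ m(a) → m(b)` -/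
  box_imp : ∀ (m : I) (a b : A),
    box m (imp a b) + imp (box m a) (box m b) = imp (box m a) (box m b)

/-- The members of the variety `R(I)`. -/
structure IModalRirig (I : Type u) where
  carrier : Type w
  [inst : ModalRirig I carrier]

attribute [instance] IModalRirig.inst

section Semantics

variable {I : Type u} {Var : Type v}

/-- The value of a formula under the homomorphism to `A` that extends `a : Var → A`. -/
def Fm.eval {A : Type w} [ModalRirig I A] (a : Var → A) : Fm I Var → A
  | .var x => a x
  | .bot => 0
  | .disj φ ψ => φ.eval a + ψ.eval a
  | .mul φ ψ => φ.eval a * ψ.eval a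
  | .imp φ ψ => ModalRirig.imp I (φ.eval a) (ψ.eval a)
  | .box m φ => ModalRirig.box m (φ.eval a)

/-- The equation `φ ≈ ψ` is the pair `(φ, ψ)`. -/
abbrev Equation (I : Type u) (Var : Type v) := Fm I Var × Fm I Var

/-- `(A, a) ⊨ ε`. -/
def Satisfies (A : IModalRirig.{u, w} I) (a : Var → A.carrier) (ε : Equation I Var) : Prop :=
  ε.1.eval a = ε.2.eval a

/-- `Θ ⊨_K ε`, the equational consequence relation of the class `K`. -/
def EqEntails (K : Set (IModalRirig.{u, w} I)) (Θ : Set (Equation I Var))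
    (ε : Equation I Var) : Prop :=
  ∀ A ∈ K, ∀ a : Var → A.carrier, (∀ θ ∈ Θ, Satisfies A a θ) → Satisfies A a ε

/-- A subvariety of `R(I)`: the class of all `I`-modal ririgs in which the equations of some set
are valid. -/
def IsSubvariety (V : Set (IModalRirig.{u, w} I)) : Prop :=
  ∃ E : Set (Equation I ℕ), V = {A | ∀ ε ∈ E, ∀ a : ℕ → A.carrier, Satisfies A a ε}

/-- The substitution `σ` acting on equations. -/
def Equation.subst (σ : Var → Fm I Var) (ε : Equation I Var) : Equation I Var :=
  (ε.1.subst σ, ε.2.subst σ)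

/-- `L` is algebraizable (in the sense of Blok and Pigozzi) with equivalent algebraic
semantics `K`. -/
def IsAlgebraizedBy (L : DeductiveSystem I Var) (K : Set (IModalRirig.{u, w} I)) : Prop :=
  ∃ (τ : Fm I Var → Set (Equation I Var)) (ρ : Equation I Var → Set (Fm I Var)),
    (∀ (σ : Var → Fm I Var) φ, τ (φ.subst σ) = Equation.subst σ '' τ φ) ∧
    (∀ (σ : Var → Fm I Var) ε, ρ (Equation.subst σ ε) = Fm.subst σ '' ρ ε) ∧
    (∀ Γ φ, L.Entails Γ φ ↔ ∀ ε ∈ τ φ, EqEntails K (⋃ γ ∈ Γ, τ γ) ε) ∧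
    (∀ Θ ε, EqEntails K Θ ε ↔ ∀ φ ∈ ρ ε, L.Entails (⋃ θ ∈ Θ, ρ θ) φ) ∧
    (∀ φ, (∀ χ ∈ ⋃ ε ∈ τ φ, ρ ε, L.Entails {φ} χ) ∧ L.Entails (⋃ ε ∈ τ φ, ρ ε) φ) ∧
    (∀ ε, (∀ δ ∈ ⋃ φ ∈ ρ ε, τ φ, EqEntails K {ε} δ) ∧ EqEntails K (⋃ φ ∈ ρ ε, τ φ) ε)

end Semantics

section LDDT

variable {I : Type u} {Var : Type v}

/-- The family `(d_j(p, q))_{j ∈ J}` of sets of formulas in two variables `p = var 0`, `q = var 1`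
witnesses the local deduction-detachment theorem for `L`. -/
def IsLDDTFamily (L : DeductiveSystem I Var) {J : Type w} (d : J → Set (Fm I (Fin 2))) : Prop :=
  ∀ (Γ : Set (Fm I Var)) (φ ψ : Fm I Var),
    L.Entails (Γ ∪ {φ}) ψ ↔ ∃ j, ∀ δ ∈ d j, L.Entails Γ (δ.subst ![φ, ψ])

/-- The local deduction-detachment theorem holds for `L`. -/
def HasLDDT (L : DeductiveSystem I Var) : Prop :=
  ∃ (J : Type u) (d : J → Set (Fm I (Fin 2))), IsLDDTFamily L d

/-- `d_{M₁,…,Mₙ}(p, q) = {M₁(p) · … · Mₙ(p) → q}`. -/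
def blockFamily (I : Type u) (Ms : List (List I)) : Set (Fm I (Fin 2)) :=
  {Fm.imp (Fm.prod (Ms.map fun M => Fm.block M (Fm.var 0))) (Fm.var 1)}

/-- `d_{n,l}(p, q) = {λ^l(p) · … · λ^l(p) → q}` with `n` factors. -/
def lamFamily {k : ℕ} (e : Fin k ≃ I) (nl : ℕ × ℕ) : Set (Fm I (Fin 2)) :=
  {Fm.imp (Fm.prod (List.replicate nl.1 (Fm.lamIter e nl.2 (Fm.var 0)))) (Fm.var 1)}

end LDDT

end IModal

namespace IModal

open Fm

section Monoid

variable {I : Type u} {Var : Type v} {Γ : Set (Fm I Var)} {φ ψ χ θ : Fm I Var}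

namespace Derivable

theorem refl (φ : Fm I Var) : Derivable Γ (imp φ φ) := .ax (.a1 φ)

theorem trans (h₁ : Derivable Γ (imp φ ψ)) (h₂ : Derivable Γ (imp ψ χ)) :
    Derivable Γ (imp φ χ) :=
  .mp (.mp (.ax (.a2 _ _ _)) h₁) h₂

theorem curry (h : Derivable Γ (imp (mul φ ψ) χ)) : Derivable Γ (imp ψ (imp φ χ)) :=
  .mp (.ax (.a5 _ _ _)) h

theorem uncurry (h : Derivable Γ (imp ψ (imp φ χ))) : Derivable Γ (imp (mul φ ψ) χ) :=
  .mp (.ax (.a6 _ _ _)) h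

theorem mul_comm (φ ψ : Fm I Var) : Derivable Γ (imp (mul φ ψ) (mul ψ φ)) := .ax (.a4 _ _)

theorem mul_left (φ ψ : Fm I Var) : Derivable Γ (imp (mul φ ψ) φ) := .ax (.a3 _ _)

theorem mul_right (φ ψ : Fm I Var) : Derivable Γ (imp (mul φ ψ) ψ) :=
  (mul_comm φ ψ).trans (mul_left ψ φ)

theorem top : Derivable Γ (top : Fm I Var) := refl _

/-- Weakening of a theorem by a premise. -/
theorem const (h : Derivable Γ φ) (ψ : Fm I Var) : Derivable Γ (imp ψ φ) :=
  .mp (mul_right ψ φ).curry h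

theorem mul_intro (h₁ : Derivable Γ φ) (h₂ : Derivable Γ ψ) : Derivable Γ (mul φ ψ) :=
  .mp (.mp (refl (mul φ ψ)).curry h₂) h₁

theorem mul_mono_left (h : Derivable Γ (imp φ ψ)) (χ : Fm I Var) :
    Derivable Γ (imp (mul φ χ) (mul ψ χ)) :=
  (mul_comm φ χ).trans (h.trans ((mul_comm χ ψ).curry)).uncurry

theorem mul_mono_right (φ : Fm I Var) (h : Derivable Γ (imp ψ χ)) :
    Derivable Γ (imp (mul φ ψ) (mul φ χ)) :=
  (h.trans (refl (mul φ χ)).curry).uncurry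

theorem mul_mono (h₁ : Derivable Γ (imp φ ψ)) (h₂ : Derivable Γ (imp χ θ)) :
    Derivable Γ (imp (mul φ χ) (mul ψ θ)) :=
  (mul_mono_left h₁ χ).trans (mul_mono_right ψ h₂)

theorem mul_assoc (φ ψ χ : Fm I Var) :
    Derivable Γ (imp (mul φ (mul ψ χ)) (mul (mul φ ψ) χ)) :=
  ((refl (mul (mul φ ψ) χ)).curry.trans (.ax (.a5 _ _ _))).uncurry.uncurry

theorem to_mul_top (φ : Fm I Var) : Derivable Γ (imp φ (mul φ Fm.top)) :=
  .mp (refl (mul φ Fm.top)).curry top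

/-- Modus ponens under premises. -/
theorem mp_mul (h₁ : Derivable Γ (imp φ (imp χ θ))) (h₂ : Derivable Γ (imp ψ χ)) :
    Derivable Γ (imp (mul φ ψ) θ) :=
  ((mul_mono_right φ h₂).trans (mul_comm φ χ)).trans h₁.uncurry

/-- The rule for `∨` under premises. -/
theorem disjE_mul {α β : Fm I Var} (h₁ : Derivable Γ (imp α (imp φ χ)))
    (h₂ : Derivable Γ (imp β (imp ψ χ))) :
    Derivable Γ (imp (mul α β) (imp (disj φ ψ) χ)) := by
  have h₁' := ((mul_left α β).trans h₁).uncurry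
  have h₂' := ((mul_right α β).trans h₂).uncurry
  have h := Derivable.disjE ((mul_comm (mul α β) φ).trans h₁')
    ((mul_comm (mul α β) ψ).trans h₂')
  exact ((mul_comm (disj φ ψ) (mul α β)).trans (.trans (.ax (.a9 _ _ _)) h)).curry

theorem box_mono (m : I) (h : Derivable Γ (imp φ ψ)) :
    Derivable Γ (imp (box m φ) (box m ψ)) :=
  .mp (.ax (.m12 _ _ _)) (.nec m h)

theorem box_mul (m : I) (φ ψ : Fm I Var) :
    Derivable Γ (imp (mul (box m φ) (box m ψ)) (box m (mul φ ψ))) :=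
  ((box_mono m (refl (mul φ ψ)).curry).trans (.ax (.m12 _ _ _))).uncurry

theorem block_intro (M : List I) (h : Derivable Γ φ) : Derivable Γ (block M φ) := by
  induction M with
  | nil => exact h
  | cons m N ih => exact .nec m ih

theorem prod_cons (φ : Fm I Var) (l : List (Fm I Var)) :
    Derivable Γ (imp (prod (φ :: l)) (mul φ (prod l))) := by
  cases l with
  | nil => exact to_mul_top φ
  | cons χ l => exact refl _

theorem mul_prod (φ : Fm I Var) (l : List (Fm I Var)) :
    Derivable Γ (imp (mul φ (prod l)) (prod (φ :: l))) := by
  cases l with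
  | nil => exact mul_left _ _
  | cons χ l => exact refl _

theorem prod_intro {l : List (Fm I Var)} (h : ∀ φ ∈ l, Derivable Γ φ) :
    Derivable Γ (prod l) := by
  induction l with
  | nil => exact top
  | cons φ l ih =>
    rw [List.forall_mem_cons] at h
    exact .mp (mul_prod φ l) (mul_intro h.1 (ih h.2))

theorem prod_append (l₁ l₂ : List (Fm I Var)) :
    Derivable Γ (imp (prod (l₁ ++ l₂)) (mul (prod l₁) (prod l₂))) := by
  induction l₁ with
  | nil => exact (to_mul_top _).trans (mul_comm _ _)
  | cons φ l ih =>
    exact (prod_cons φ (l ++ l₂)).trans (((mul_mono_right φ ih).trans (mul_assoc _ _ _)).trans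
      (mul_mono_left (mul_prod φ l) _))

theorem prod_map_box (m : I) (l : List (Fm I Var)) :
    Derivable Γ (imp (prod (l.map (box m))) (box m (prod l))) := by
  induction l with
  | nil => exact .ax (.m11r m)
  | cons φ l ih =>
    exact (prod_cons (box m φ) (l.map (box m))).trans (((mul_mono_right _ ih).trans
      (box_mul m φ (prod l))).trans (box_mono m (mul_prod φ l)))

theorem prod_mono {α : Type*} {f g : α → Fm I Var} {l : List α}
    (h : ∀ x ∈ l, Derivable Γ (imp (f x) (g x))) :
    Derivable Γ (imp (prod (l.map f)) (prod (l.map g))) := by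
  induction l with
  | nil => exact refl _
  | cons x l ih =>
    rw [List.forall_mem_cons] at h
    exact (prod_cons (f x) (l.map f)).trans ((mul_mono h.1 (ih h.2)).trans
      (mul_prod (g x) (l.map g)))

theorem prod_mem {l : List (Fm I Var)} (h : φ ∈ l) : Derivable Γ (imp (prod l) φ) := by
  induction l with
  | nil => simp at h
  | cons χ l ih =>
    rcases List.mem_cons.mp h with rfl | h
    · exact (prod_cons _ _).trans (mul_left _ _)
    · exact ((prod_cons _ _).trans (mul_right _ _)).trans (ih h)

theorem mono {Δ : Set (Fm I Var)} (h : Derivable Γ φ) (hs : Γ ⊆ Δ) : Derivable Δ φ :=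
  h.cut fun _ hγ => .hyp (hs hγ)

/-- Premises in `Δ` can be moved to the left of `→`, as a finite product of members of any set
`S ⊇ Δ` of formulas that is closed under the operators `m ∈ I`. -/
theorem exists_prod_imp {Δ S : Set (Fm I Var)} (hΔ : Δ ⊆ S)
    (hS : ∀ (m : I), ∀ φ ∈ S, box m φ ∈ S) (h : Derivable (Γ ∪ Δ) ψ) :
    ∃ l : List (Fm I Var), (∀ φ ∈ l, φ ∈ S) ∧ Derivable Γ (imp (prod l) ψ) := by
  induction h with
  | ax h => exact ⟨[], by simp, const (.ax h) _⟩
  | @hyp φ h =>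
    rcases h with h | h
    · exact ⟨[], by simp, const (.hyp h) _⟩
    · exact ⟨[φ], by simpa using hΔ h, refl _⟩
  | mp _ _ ih₁ ih₂ =>
    obtain ⟨l₁, hl₁, h₁⟩ := ih₁
    obtain ⟨l₂, hl₂, h₂⟩ := ih₂
    exact ⟨l₁ ++ l₂, List.forall_mem_append.mpr ⟨hl₁, hl₂⟩,
      (prod_append l₁ l₂).trans (mp_mul h₁ h₂)⟩
  | nec m _ ih =>
    obtain ⟨l, hl, h⟩ := ih
    refine ⟨l.map (box m), ?_, (prod_map_box m l).trans (box_mono m h)⟩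
    simpa using fun φ hφ => hS m φ (hl φ hφ)
  | disjE _ _ ih₁ ih₂ =>
    obtain ⟨l₁, hl₁, h₁⟩ := ih₁
    obtain ⟨l₂, hl₂, h₂⟩ := ih₂
    exact ⟨l₁ ++ l₂, List.forall_mem_append.mpr ⟨hl₁, hl₂⟩,
      (prod_append l₁ l₂).trans (disjE_mul h₁ h₂)⟩

theorem of_prod_imp {Δ : Set (Fm I Var)} {l : List (Fm I Var)}
    (hl : ∀ φ ∈ l, Derivable Δ φ) (h : Derivable Γ (imp (prod l) ψ)) :
    Derivable (Γ ∪ Δ) ψ :=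
  .mp (h.mono Set.subset_union_left)
    (prod_intro fun φ hφ => (hl φ hφ).mono Set.subset_union_right)

theorem union_iff_block {Δ : Set (Fm I Var)} :
    Derivable (Γ ∪ Δ) ψ ↔ ∃ l : List (List I × Fm I Var), (∀ p ∈ l, p.2 ∈ Δ) ∧
      Derivable Γ (imp (prod (l.map fun p => block p.1 p.2)) ψ) := by
  constructor
  · intro h
    obtain ⟨l, hl, h⟩ := exists_prod_imp
      (S := (fun p : List I × Fm I Var => block p.1 p.2) '' {p | p.2 ∈ Δ})
      (fun φ hφ => ⟨([], φ), hφ, rfl⟩)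
      (by rintro m _ ⟨p, hp, rfl⟩; exact ⟨(m :: p.1, p.2), hp, rfl⟩) h
    obtain ⟨l, rfl⟩ : l ∈ Set.range (List.map fun p : {p : List I × Fm I Var // p.2 ∈ Δ} =>
        block p.1.1 p.1.2) := by
      rw [Set.range_list_map]
      intro φ hφ
      obtain ⟨p, hp, rfl⟩ := hl φ hφ
      exact ⟨⟨p, hp⟩, rfl⟩
    refine ⟨l.map Subtype.val, ?_, by simpa [Function.comp_def] using h⟩
    simp only [List.mem_map]
    rintro _ ⟨p, _, rfl⟩
    exact p.2
  · rintro ⟨l, hl, h⟩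
    refine of_prod_imp (fun φ hφ => ?_) h
    obtain ⟨p, hp, rfl⟩ := List.mem_map.mp hφ
    exact block_intro _ (.hyp (hl p hp))

section Finite

variable {k : ℕ} (e : Fin k ≃ I)

theorem lamIter_succ (l : ℕ) (φ : Fm I Var) : lamIter e (l + 1) φ = lam e (lamIter e l φ) :=
  Function.iterate_succ_apply' _ _ _

theorem lamIter_intro (l : ℕ) (h : Derivable Γ φ) : Derivable Γ (lamIter e l φ) := by
  induction l with
  | zero => exact h
  | succ l ih =>
    rw [lamIter_succ]
    refine mul_intro ih (prod_intro fun χ hχ => ?_)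
    obtain ⟨j, rfl⟩ := (List.mem_ofFn' _ _).mp hχ
    exact .nec _ ih

theorem lam_box (m : I) (φ : Fm I Var) : Derivable Γ (imp (lam e φ) (box m φ)) :=
  (mul_right _ _).trans (prod_mem ((List.mem_ofFn' _ _).mpr ⟨e.symm m, by simp⟩))

theorem lamIter_block {M : List I} {l : ℕ} (h : M.length ≤ l) (φ : Fm I Var) :
    Derivable Γ (imp (lamIter e l φ) (block M φ)) := by
  induction l generalizing M with
  | zero =>
    obtain rfl : M = [] := by simpa using h
    exact refl _
  | succ l ih =>
    rw [lamIter_succ]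
    cases M with
    | nil => exact (mul_left _ _).trans (ih (M := []) (by simp))
    | cons m N => exact (lam_box e m _).trans (box_mono m (ih (by simpa using h)))

theorem union_iff_lamIter {Δ : Set (Fm I Var)} :
    Derivable (Γ ∪ Δ) ψ ↔ ∃ (n : ℕ) (l : List (Fm I Var)), (∀ φ ∈ l, φ ∈ Δ) ∧
      Derivable Γ (imp (prod (l.map (lamIter e n))) ψ) := by
  constructor
  · rw [union_iff_block]
    rintro ⟨l, hl, h⟩
    refine ⟨(l.map fun p => p.1.length).sum, l.map Prod.snd, by simpa using fun φ M => hl (M, φ), ?_⟩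
    rw [List.map_map]
    refine (prod_mono fun p hp => lamIter_block e ?_ _).trans h
    exact List.le_sum_of_mem (List.mem_map_of_mem hp)
  · rintro ⟨n, l, hl, h⟩
    refine of_prod_imp (fun φ hφ => ?_) h
    obtain ⟨χ, hχ, rfl⟩ := List.mem_map.mp hφ
    exact lamIter_intro e n (.hyp (hl χ hχ))

end Finite

end Derivable

theorem exists_list_iff_exists_fin {α : Type*} {P : List α → Prop} :
    (∃ l, P l) ↔ ∃ (n : ℕ) (f : Fin n → α), P (List.ofFn f) :=
  ⟨fun ⟨l, h⟩ => ⟨l.length, l.get, by rwa [List.ofFn_get]⟩, fun ⟨_, f, h⟩ => ⟨List.ofFn f, h⟩⟩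

end Monoid

section Subst

variable {I : Type u} {Var : Type v} {Var' : Type w} (σ : Var → Fm I Var')

theorem Fm.subst_block (M : List I) (φ : Fm I Var) :
    (block M φ).subst σ = block M (φ.subst σ) := by
  induction M with
  | nil => rfl
  | cons m N ih => exact congrArg (box m) ih

theorem Fm.subst_prod (l : List (Fm I Var)) :
    (prod l).subst σ = prod (l.map (Fm.subst σ)) := by
  induction l with
  | nil => rfl
  | cons φ l ih =>
    cases l with
    | nil => rfl
    | cons χ l => exact congrArg (mul (φ.subst σ)) ih

theorem Fm.subst_lamIter {k : ℕ} (e : Fin k ≃ I) (l : ℕ) (φ : Fm I Var) :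
    (lamIter e l φ).subst σ = lamIter e l (φ.subst σ) := by
  induction l with
  | zero => rfl
  | succ l ih =>
    simp only [Derivable.lamIter_succ, lam, Fm.subst, subst_prod, ih, List.map_ofFn,
      Function.comp_def]

end Subst

section LDDT

variable {I : Type u} {Var : Type v}

theorem isLDDTFamily_blockFamily : IsLDDTFamily (SH I Var) (blockFamily I) := by
  intro Γ φ ψ
  refine Derivable.union_iff_block.trans ?_
  simp only [blockFamily, Set.mem_singleton_iff, forall_eq, Fm.subst, Fm.subst_prod,
    List.map_map, Function.comp_def, Fm.subst_block]
  constructor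
  · rintro ⟨l, hl, h⟩
    refine ⟨l.map Prod.fst, ?_⟩
    rw [List.map_map]
    rwa [List.map_congr_left fun p hp => by rw [hl p hp]] at h
  · rintro ⟨Ms, h⟩
    refine ⟨Ms.map fun M => (M, φ), by simp, ?_⟩
    rw [List.map_map]
    exact h

theorem isLDDTFamily_lamFamily {k : ℕ} (e : Fin k ≃ I) :
    IsLDDTFamily (SH I Var) (lamFamily e) := by
  intro Γ φ ψ
  refine (Derivable.union_iff_lamIter e).trans ?_
  simp only [lamFamily, Set.mem_singleton_iff, forall_eq, Fm.subst, Fm.subst_prod,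
    List.map_replicate, Fm.subst_lamIter]
  constructor
  · rintro ⟨n, l, hl, h⟩
    rw [List.eq_replicate_of_mem hl, List.map_replicate] at h
    exact ⟨(_, n), h⟩
  · rintro ⟨⟨n, l⟩, h⟩
    exact ⟨l, List.replicate n φ, fun _ => List.eq_of_mem_replicate,
      by rw [List.map_replicate]; exact h⟩

end LDDT

end IModal

theorem mainTheorem2 {I : Type u} {Var : Type v} :
    -- the parametrized theorem for axiomatic extensions of `S_H`
    (∀ (L : IModal.DeductiveSystem I Var) (V : Set (IModal.IModalRirig.{u, w} I)),
      IModal.IsAxiomaticExtension L → IModal.IsSubvariety V → IModal.IsAlgebraizedBy L V →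
      ∀ (Γ Δ : Set (IModal.Fm I Var)) (ψ : IModal.Fm I Var),
        L.Entails (Γ ∪ Δ) ψ ↔
          ∃ (n : ℕ) (M : Fin n → List I) (χ : Fin n → IModal.Fm I Var),
            (∀ j, χ j ∈ Δ) ∧
            L.Entails Γ
              (IModal.Fm.imp (IModal.Fm.prod (List.ofFn fun j => IModal.Fm.block (M j) (χ j))) ψ)) ∧
    -- the same for finite `I = {m₁, …, m_k}`, with `λ^l` in place of the blocks
    (∀ (k : ℕ) (e : Fin k ≃ I)
      (L : IModal.DeductiveSystem I Var) (V : Set (IModal.IModalRirig.{u, w} I)),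
      IModal.IsAxiomaticExtension L → IModal.IsSubvariety V → IModal.IsAlgebraizedBy L V →
      ∀ (Γ Δ : Set (IModal.Fm I Var)) (ψ : IModal.Fm I Var),
        L.Entails (Γ ∪ Δ) ψ ↔
          ∃ (n l : ℕ) (χ : Fin n → IModal.Fm I Var),
            (∀ j, χ j ∈ Δ) ∧
            L.Entails Γ
              (IModal.Fm.imp (IModal.Fm.prod (List.ofFn fun j => IModal.Fm.lamIter e l (χ j))) ψ)) ∧
    -- the local deduction-detachment theorem for `S_H`, with explicit families
    IModal.HasLDDT (IModal.SH I Var) ∧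
    IModal.IsLDDTFamily (IModal.SH I Var) (IModal.blockFamily I) ∧
    (∀ (k : ℕ) (e : Fin k ≃ I),
      IModal.IsLDDTFamily (IModal.SH I Var) (IModal.lamFamily e)) := by
  refine ⟨?_, ?_, ⟨_, _, IModal.isLDDTFamily_blockFamily⟩, IModal.isLDDTFamily_blockFamily,
    fun _ e => IModal.isLDDTFamily_lamFamily e⟩
  · rintro L - ⟨Ax, hL⟩ - - Γ Δ ψ
    simp only [hL]
    rw [Set.union_right_comm]
    refine IModal.Derivable.union_iff_block.trans (IModal.exists_list_iff_exists_fin.trans ?_)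
    simp only [List.forall_mem_ofFn_iff, List.map_ofFn]
    exact exists_congr fun n =>
      ⟨fun ⟨f, h⟩ => ⟨fun j => (f j).1, fun j => (f j).2, h⟩,
        fun ⟨M, χ, h⟩ => ⟨fun j => (M j, χ j), h⟩⟩
  · rintro k e L - ⟨Ax, hL⟩ - - Γ Δ ψ
    simp only [hL]
    rw [Set.union_right_comm]
    refine (IModal.Derivable.union_iff_lamIter e).trans ?_
    simp only [IModal.exists_list_iff_exists_fin, List.forall_mem_ofFn_iff, List.map_ofFn]
    exact exists_comm
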